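/- All graphs are finite and simple. For a graph $H$ with vertex set $W$ and adjacency matrix $A(H)$, let $\mathrm{Supp}(H)$ be the set of vertices $v \in W$ such that $x_v \ne 0$ for some $x \in \mathbb{R}^{W}$ with $A(H)x = 0$. Let $\mathcal{F}_S(H)$ be the subgraph of $H$ induced by the closed neighbourhood $N[\mathrm{Supp}(H)]$, and let $\mathcal{F}_N(H) = H - \mathcal{F}_S(H)$ be the subgraph induced by the remaining vertices. Let $\alpha(H)$ denote the independence number of $H$. A graph $G$ is unicyclic if it is connected and contains exactly one cycle $C$. For $v \in V(C)$, the pendant tree $G\{v\}$ is the largest connected induced subgraph of $G$ that contains $v$ and no other vertex of $C$. The unicyclic graph $G$ is of Type II if, for every $v \in V(C)$, some maximum matching of $G\{v\}$ does not saturate $v$ (when $G\{v\}$ is the single vertex $v$, this holds through the empty matching). **Theorem.** Let $G$ be a unicyclic graph of Type II with cycle $C$, and let $T_1,\dots,T_k$ ($k \ge 0$) be the connected components of $G - C$, the graph obtained from $G$ by deleting the vertices of $C$. Then $$\alpha(G) = \left\lfloor \frac{|V(C)|}{2} \right\rfloor + \sum_{i=1}^{k} \left( |\mathrm{Supp}(T_i)|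 + \frac{|V(\mathcal{F}_N(T_i))|}{2} \right).$$ -/

import Mathlib

namespace UnicyclicNull

variable {V W : Type*}

/-- A subgraph is a cycle when it is formed by the vertices and edges of a closed walk which is a
cycle (of length at least three, without repeated vertices). -/
def IsCycleSubgraph {G : SimpleGraph V} (C : G.Subgraph) : Prop :=
  ∃ (v : V) (p : G.Walk v v), p.IsCycle ∧ C = p.toSubgraph

/-- A unicyclic graph: connected, with exactly one cycle. -/
def IsUnicyclic (G : SimpleGraph V) : Prop :=
  G.Connected ∧ ∃! C : G.Subgraph, IsCycleSubgraph C

/-- The vertices of the pendant tree `G{v}` at a vertex `v` of `C`: those joined to `v` by a walk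
of `G` that meets `C` in no vertex other than `v`. -/
def pendantVerts (G : SimpleGraph V) (C : G.Subgraph) (v : V) : Set V :=
  {w | ∃ p : G.Walk v w, ∀ x ∈ p.support, x ∈ C.verts → x = v}

/-- The pendant tree `G{v}`, as an induced subgraph. -/
def pendantTree (G : SimpleGraph V) (C : G.Subgraph) (v : V) :
    SimpleGraph (pendantVerts G C v) :=
  G.induce (pendantVerts G C v)

theorem mem_pendantVerts_self (G : SimpleGraph V) (C : G.Subgraph) (v : V) :
    v ∈ pendantVerts G C v :=
  ⟨SimpleGraph.Walk.nil, by simp⟩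

/-- The pendant tree is the largest connected induced subgraph which contains `v` and no other
vertex of `C`. -/
theorem pendantVerts_isGreatest (G : SimpleGraph V) (C : G.Subgraph) (v : V) :
    IsGreatest {S : Set V | (G.induce S).Connected ∧ v ∈ S ∧ ∀ x ∈ S, x ∈ C.verts → x = v}
      (pendantVerts G C v) := by
  refine ⟨⟨?_, mem_pendantVerts_self G C v, ?_⟩, ?_⟩
  · rw [SimpleGraph.connected_iff_exists_forall_reachable]
    refine ⟨⟨v, mem_pendantVerts_self G C v⟩, ?_⟩
    rintro ⟨w, p, hp⟩
    classical
    have hs : ∀ x ∈ p.support, x ∈ pendantVerts G C v := fun x hx =>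
      ⟨p.takeUntil x hx, fun y hy => hp y (p.support_takeUntil_subset_support hx hy)⟩
    exact ⟨p.induce _ hs⟩
  · rintro x ⟨p, hp⟩ hx
    exact hp x p.end_mem_support hx
  · rintro S ⟨hS, hv, hC⟩ w hw
    obtain ⟨p⟩ := hS.preconnected ⟨v, hv⟩ ⟨w, hw⟩
    have hq : (p.map (SimpleGraph.Embedding.induce S).toHom).support =
        p.support.map Subtype.val := SimpleGraph.Walk.support_map _ p
    refine ⟨p.map (SimpleGraph.Embedding.induce S).toHom, fun x hx => ?_⟩
    obtain ⟨y, -, rfl⟩ := List.mem_map.1 (hq ▸ hx)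
    exact hC _ y.2

/-- A matching with the largest possible number of edges (used for finite graphs). -/
def IsMaximumMatching {H : SimpleGraph W} (M : H.Subgraph) : Prop :=
  M.IsMatching ∧ ∀ M' : H.Subgraph, M'.IsMatching → M'.edgeSet.ncard ≤ M.edgeSet.ncard

/-- `v` is mismatched in `H`: some maximum matching of `H` does not saturate `v`. (The vertex of a
one-vertex graph is mismatched, by the empty matching.) -/
def IsMismatched (H : SimpleGraph W) (v : W) : Prop :=
  ∃ M : H.Subgraph, IsMaximumMatching M ∧ v ∉ M.verts

/-- Type I: some vertex `v` of the cycle is matched in its pendant tree. -/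
def IsTypeI (G : SimpleGraph V) : Prop :=
  IsUnicyclic G ∧ ∃ C : G.Subgraph, IsCycleSubgraph C ∧ ∃ v ∈ C.verts,
    ¬ IsMismatched (pendantTree G C v) ⟨v, mem_pendantVerts_self G C v⟩

/-- Type II: a unicyclic graph that is not of Type I. -/
def IsTypeII (G : SimpleGraph V) : Prop :=
  IsUnicyclic G ∧ ¬ IsTypeI G

open Classical in
/-- The null space of the real adjacency matrix of a finite graph. -/
noncomputable def nullSpace [Finite W] (H : SimpleGraph W) : Submodule ℝ (W → ℝ) :=
  letI := Fintype.ofFinite W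
  LinearMap.ker (H.adjMatrix ℝ).mulVecLin

/-- `Supp(H)`: the vertices at which some vector of the null space is nonzero. -/
def supp [Finite W] (H : SimpleGraph W) : Set W :=
  {v | ∃ x ∈ nullSpace H, x v ≠ 0}

/-- The closed neighbourhood `N[S]`. -/
def closedNeighborhood (H : SimpleGraph W) (S : Set W) : Set W :=
  S ∪ ⋃ v ∈ S, H.neighborSet v

/-- The S-forest: the subgraph induced by the closed neighbourhood of the support. -/
def sForest [Finite W] (H : SimpleGraph W) : H.Subgraph :=
  (⊤ : H.Subgraph).induce (closedNeighborhood H (supp H))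

/-- The N-forest: what remains of the graph when the vertices of the S-forest are deleted. -/
def nForest [Finite W] (H : SimpleGraph W) : H.Subgraph :=
  (⊤ : H.Subgraph).deleteVerts (sForest H).verts

/-- `G - C`: the graph induced on the vertices outside `C`. -/
def minus (G : SimpleGraph V) (C : G.Subgraph) : SimpleGraph ↥(C.vertsᶜ) :=
  G.induce C.vertsᶜ

end UnicyclicNull

/-! The formula combines three facts: `α(G) = ⌊|C|/2⌋ + α(G - C)` (`IsTypeII.indepNum_eq`),
additivity of `α` over components (`indepNum_eq_finsum`), and `α(F) = |Supp F| + |F_N(F)|/2` for a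
forest (`indepNum_of_isAcyclic`).

For forests, strip off a leaf `u` together with its neighbour `w`. This lowers `2|Supp| + |F_N|` by
exactly 2 (`card_suppOn_add_card_farOn`) and takes one vertex from an independent set `I` and one
edge from a matching `M` with `|I| + |M| = |V|`. Such a pair is optimal, since an independent set
misses an end of every matching edge. Induced subgraphs are treated as vertex sets `S` of one fixed
graph, with null vectors extended by zero.

For the cycle, `≤` follows by cutting an independent set into its parts in and off `C`. For `≥`, the
identity `|I| + |M| = |V|` turns "`v` is mismatched in `G{v}`" into: some independent set of `G{v}`
exceeds by at least one every independent set avoiding `v`. The union of these sets over `C` has at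
least `|C| + α(G - C)` vertices, and `G` has no edges inside it except edges of `C`. Discarding the
cycle vertices outside an independent set of `⌊|C|/2⌋` vertices of `C` leaves enough. -/

namespace UnicyclicNull

open SimpleGraph Finset

/-! ### Null decomposition, independent sets and matchings of forests, by leaf removal -/

section Forest

variable {V : Type*} [Fintype V] {G : SimpleGraph V}

open Classical in
/-- The real vectors supported on `S` which are in the kernel of the adjacency matrix of `G[S]`. -/
def IsNullOn (G : SimpleGraph V) (S : Finset V) (x : V → ℝ) : Prop :=
  (∀ v ∉ S, x v = 0) ∧ ∀ v ∈ S, (G.adjMatrix ℝ).mulVec x v = 0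

open Classical in
/-- The support of the null space of `G[S]`. -/
noncomputable def suppOn (G : SimpleGraph V) (S : Finset V) : Finset V :=
  {v | ∃ x, IsNullOn G S x ∧ x v ≠ 0}

open Classical in
/-- The vertices of `S` outside the closed neighbourhood of the support of `G[S]`. -/
noncomputable def farOn (G : SimpleGraph V) (S : Finset V) : Finset V :=
  {v ∈ S | v ∉ suppOn G S ∧ ∀ z ∈ suppOn G S, ¬ G.Adj z v}

lemma mem_suppOn {S : Finset V} {v : V} :
    v ∈ suppOn G S ↔ ∃ x, IsNullOn G S x ∧ x v ≠ 0 := by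
  simp [suppOn]

lemma mem_farOn {S : Finset V} {v : V} :
    v ∈ farOn G S ↔ v ∈ S ∧ v ∉ suppOn G S ∧ ∀ z ∈ suppOn G S, ¬ G.Adj z v := by
  simp [farOn]

lemma suppOn_subset (S : Finset V) : suppOn G S ⊆ S := by
  intro v hv
  obtain ⟨x, hx, hv⟩ := mem_suppOn.1 hv
  by_contra h
  exact hv (hx.1 v h)

open Classical in
lemma mulVec_add_single (x : V → ℝ) (u v : V) (c : ℝ) :
    (G.adjMatrix ℝ).mulVec (x + Pi.single u c) v =
      (G.adjMatrix ℝ).mulVec x v + if G.Adj v u then c else 0 := by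
  rw [Matrix.mulVec_add, Pi.add_apply, Matrix.mulVec_single]
  simp [adjMatrix_apply, Matrix.col, G.adj_comm]

open Classical in
lemma mulVec_eq_of_leaf {S : Finset V} {u w : V} (huw : G.Adj u w)
    (hu : ∀ z ∈ S, G.Adj u z → z = w) {x : V → ℝ} (hx : ∀ v ∉ S, x v = 0) :
    (G.adjMatrix ℝ).mulVec x u = x w := by
  rw [adjMatrix_mulVec_apply, Finset.sum_eq_single w]
  · intro b hb hbw
    by_contra h
    refine hbw (hu b ?_ (by simpa using hb))
    by_contra h'
    exact h (hx b h')
  · intro h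
    exact absurd (by simpa using huw) h

open Classical in
/-- Restriction of a null vector after deletion of a leaf and its neighbour. -/
lemma IsNullOn.restrict {S : Finset V} {u w : V} (huS : u ∈ S) (hw : w ∈ S) (huw : G.Adj u w)
    (hu : ∀ z ∈ S, G.Adj u z → z = w) {x : V → ℝ} (hx : IsNullOn G S x) :
    x w = 0 ∧ IsNullOn G (S \ {u, w}) (x + Pi.single u (-x u)) := by
  have hxw : x w = 0 := by
    rw [← mulVec_eq_of_leaf huw hu hx.1]; exact hx.2 u huS
  refine ⟨hxw, ?_, ?_⟩
  · intro v hv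
    by_cases hvu : v = u
    · subst hvu; simp
    · by_cases hvw : v = w
      · subst hvw; simp [hxw, hvu]
      · have : v ∉ S := fun h => hv (by simp [h, hvu, hvw])
        simp [hx.1 v this, hvu]
  · intro v hv
    simp only [mem_sdiff, mem_insert, mem_singleton, not_or] at hv
    rw [mulVec_add_single, hx.2 v hv.1, if_neg, add_zero]
    intro h
    exact hv.2.2 (hu v hv.1 h.symm)

open Classical in
/-- Extension of a null vector after addition of a leaf and its neighbour. -/
lemma IsNullOn.extend {S : Finset V} {u w : V} (huS : u ∈ S) (hw : w ∈ S) (huw : G.Adj u w)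
    (hu : ∀ z ∈ S, G.Adj u z → z = w) {y : V → ℝ} (hy : IsNullOn G (S \ {u, w}) y) :
    IsNullOn G S (y + Pi.single u (-(G.adjMatrix ℝ).mulVec y w)) := by
  refine ⟨?_, ?_⟩
  · intro v hv
    have hvu : v ≠ u := by rintro rfl; exact hv huS
    simp [hvu, hy.1 v (fun h => hv (mem_sdiff.1 h).1)]
  · intro v hv
    rw [mulVec_add_single]
    by_cases hvu : v = u
    · subst hvu
      rw [mulVec_eq_of_leaf huw hu (fun z hz => hy.1 z fun h => hz (mem_sdiff.1 h).1)]
      simp [hy.1 w (by simp)]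
    · by_cases hvw : v = w
      · subst hvw; simp [huw.symm]
      · rw [hy.2 v (by simp [hv, hvu, hvw]), if_neg, add_zero]
        intro h
        exact hvw (hu v hv h.symm)

-- Restriction and extension of null vectors change only the coordinate at `u`. The case `v = w` is
-- included because null vectors vanish at the neighbour of a leaf.
open Classical in
lemma mem_suppOn_of_ne_leaf {S : Finset V} {u w : V} (huS : u ∈ S) (hw : w ∈ S)
    (huw : G.Adj u w) (hu : ∀ z ∈ S, G.Adj u z → z = w) {v : V} (hv : v ≠ u) :
    v ∈ suppOn G S ↔ v ∈ suppOn G (S \ {u, w}) := by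
  simp only [mem_suppOn]
  constructor
  · rintro ⟨x, hx, hxv⟩
    exact ⟨_, (hx.restrict huS hw huw hu).2, by simpa [hv] using hxv⟩
  · rintro ⟨y, hy, hyv⟩
    exact ⟨_, IsNullOn.extend huS hw huw hu hy, by simpa [hv] using hyv⟩

/-- A null vector of an acyclic graph which is nonzero at one neighbour `z` of a deleted vertex `w`
can be replaced by one vanishing at the other neighbours. -/
lemma IsNullOn.exists_isolate (hG : G.IsAcyclic) {S : Finset V} {w z : V} (hw : w ∉ S)
    (hwz : G.Adj w z) {x : V → ℝ} (hx : IsNullOn G S x) :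
    ∃ y, IsNullOn G S y ∧ y z = x z ∧ ∀ z', G.Adj w z' → z' ≠ z → y z' = 0 := by
  classical
  have hb := isAcyclic_iff_forall_adj_isBridge.1 hG hwz
  rw [isBridge_iff] at hb
  set G' := G \ fromEdgeSet {s(w, z)} with hG'
  have hadj : ∀ a b, G.Adj a b → ¬ (a = w ∧ b = z) → ¬ (a = z ∧ b = w) → G'.Adj a b := by
    intro a b hab h1 h2
    simp only [hG', sdiff_adj, fromEdgeSet_adj, Set.mem_singleton_iff, Sym2.eq_iff]
    tauto
  -- Keep `x` only on the side of `z` of the bridge `wz`. The result is still null because `x`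
  -- vanishes at `w`; the other neighbours of `w` lie on the far side.
  refine ⟨fun v => if G'.Reachable z v then x v else 0, ⟨?_, ?_⟩, by simp, ?_⟩
  · intro v hv; simp [hx.1 v hv]
  · intro v hv
    have hvw : v ≠ w := by rintro rfl; exact hw hv
    have key : ∀ b, G.Adj v b → (if G'.Reachable z b then x b else 0) =
        if G'.Reachable z v then x b else 0 := by
      intro b hvb
      by_cases hbw : b = w
      · subst hbw; simp [hx.1 b hw]
      · have := (hadj v b hvb (by tauto) (by tauto)).reachable
        have h : G'.Reachable z b ↔ G'.Reachable z v :=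
          ⟨fun h => h.trans this.symm, fun h => h.trans this⟩
        simp [h]
    have h0 := hx.2 v hv
    rw [adjMatrix_mulVec_apply] at h0 ⊢
    rw [Finset.sum_congr rfl (fun b hb => key b (by simpa using hb))]
    split_ifs
    · exact h0
    · simp
  · intro z' hz' hne
    refine if_neg fun h => ?_
    have hwz' := (hadj w z' hz' (by tauto) (fun h => hz'.ne h.2.symm)).reachable
    exact hb (hwz'.trans h.symm)

-- The equation at `w` makes the value at `u` minus the sum over the other neighbours of `w`. That
-- sum can be made nonzero as soon as one neighbour is supported: `IsNullOn.exists_isolate` rules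
-- out cancellation.
open Classical in
lemma leaf_mem_suppOn (hG : G.IsAcyclic) {S : Finset V} {u w : V} (huS : u ∈ S)
    (hw : w ∈ S) (huw : G.Adj u w) (hu : ∀ z ∈ S, G.Adj u z → z = w) :
    u ∈ suppOn G S ↔ ∃ z ∈ suppOn G (S \ {u, w}), G.Adj w z := by
  constructor
  · intro h
    obtain ⟨x, hx, hxu⟩ := mem_suppOn.1 h
    have h2 := (hx.restrict huS hw huw hu).2
    have h1 := hx.2 w hw
    set y := x + Pi.single u (-x u) with hy
    have hxy : x = y + Pi.single u (x u) := by rw [hy, add_assoc, ← Pi.single_add]; simp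
    rw [hxy] at h1
    erw [mulVec_add_single] at h1
    rw [if_pos huw.symm] at h1
    have : (G.adjMatrix ℝ).mulVec y w ≠ 0 := by
      intro h0; rw [h0] at h1; exact hxu (by simpa using h1)
    rw [adjMatrix_mulVec_apply] at this
    obtain ⟨z, hz, hz0⟩ := Finset.exists_ne_zero_of_sum_ne_zero this
    exact ⟨z, mem_suppOn.2 ⟨y, h2, hz0⟩, by simpa using hz⟩
  · rintro ⟨z, hz, hwz⟩
    obtain ⟨x, hx, hxz⟩ := mem_suppOn.1 hz
    obtain ⟨y, hy, hyz, hy0⟩ := hx.exists_isolate hG (by simp) hwz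
    refine mem_suppOn.2 ⟨_, IsNullOn.extend huS hw huw hu hy, ?_⟩
    · have h1 : (G.adjMatrix ℝ).mulVec y w = x z := by
        rw [adjMatrix_mulVec_apply, Finset.sum_eq_single z, hyz]
        · intro b hb hbz; exact hy0 b (by simpa using hb) hbz
        · intro h; exact absurd (by simpa using hwz) h
      have hyu : y u = 0 := hy.1 u (by simp)
      simpa [hyu, h1] using hxz

-- Either `u` enters the support, which then covers `w` and leaves the far set unchanged, or the
-- support is unchanged and both `u` and `w` become far. Both cases add 2.
open Classical in
lemma card_suppOn_add_card_farOn (hG : G.IsAcyclic) {S : Finset V} {u w : V}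
    (huS : u ∈ S) (hw : w ∈ S) (huw : G.Adj u w) (hu : ∀ z ∈ S, G.Adj u z → z = w) :
    2 * #(suppOn G S) + #(farOn G S) =
      2 * #(suppOn G (S \ {u, w})) + #(farOn G (S \ {u, w})) + 2 := by
  have hne := huw.ne
  have hs := fun v => mem_suppOn_of_ne_leaf huS hw huw hu (v := v)
  have hl := leaf_mem_suppOn hG huS hw huw hu
  have hsub := suppOn_subset (G := G) (S \ {u, w})
  have huS' : u ∉ suppOn G (S \ {u, w}) := fun h => by simpa using hsub h
  have hwS' : w ∉ suppOn G (S \ {u, w}) := fun h => by simpa using hsub h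
  by_cases h : u ∈ suppOn G S
  · have e1 : suppOn G S = insert u (suppOn G (S \ {u, w})) := by
      ext v
      by_cases hv : v = u
      · simp [hv, h]
      · simp [hs v hv, hv]
    have e2 : farOn G S = farOn G (S \ {u, w}) := by
      ext v
      rw [mem_farOn, mem_farOn, e1]
      simp only [mem_insert, not_or, forall_eq_or_imp, mem_sdiff, mem_singleton]
      constructor
      · rintro ⟨h1, ⟨h2, h3⟩, h4, h5⟩
        exact ⟨⟨h1, h2, by rintro rfl; exact h4 huw⟩, h3, h5⟩
      · rintro ⟨⟨h1, h2, h3⟩, h4, h5⟩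
        exact ⟨h1, ⟨h2, h4⟩, fun h => h3 (hu v h1 h), h5⟩
    rw [e1, e2, card_insert_of_notMem huS']
    ring
  · have e1 : suppOn G S = suppOn G (S \ {u, w}) := by
      ext v
      by_cases hv : v = u
      · simp [hv, h, huS']
      · simp [hs v hv]
    have hno : ∀ z ∈ suppOn G (S \ {u, w}), ¬ G.Adj w z := by
      intro z hz hwz; exact h (hl.2 ⟨z, hz, hwz⟩)
    have e2 : farOn G S = insert u (insert w (farOn G (S \ {u, w}))) := by
      ext v
      simp only [mem_insert]
      rw [mem_farOn, mem_farOn, e1]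
      simp only [mem_insert, mem_sdiff, mem_singleton]
      constructor
      · rintro ⟨h1, h2, h3⟩
        tauto
      · rintro (rfl | rfl | ⟨h1, h2, h3⟩)
        · refine ⟨huS, huS', fun z hz hzu => ?_⟩
          have := hsub hz
          simp only [mem_sdiff, mem_insert, mem_singleton, not_or] at this
          exact this.2.2 (hu z this.1 hzu.symm)
        · exact ⟨hw, hwS', fun z hz hzw => hno z hz hzw.symm⟩
        · exact ⟨h1.1, h2, h3⟩
    rw [e1, e2, card_insert_of_notMem, card_insert_of_notMem]
    · ring
    · simp [mem_farOn]
    · simp [mem_farOn, hne]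

lemma suppOn_eq_of_isIndepSet {S : Finset V} (hS : G.IsIndepSet S) : suppOn G S = S := by
  classical
  refine (suppOn_subset S).antisymm fun v hv => mem_suppOn.2 ⟨Pi.single v 1, ⟨?_, ?_⟩, by simp⟩
  · intro z hz
    have : z ≠ v := by rintro rfl; exact hz hv
    simp [this]
  · intro z hz
    have := mulVec_add_single (G := G) 0 v z 1
    rw [zero_add] at this
    rw [this, if_neg, Matrix.mulVec_zero]
    · simp
    · intro h; exact hS hz hv h.ne h

/-- An acyclic graph with an edge has a leaf. -/
lemma exists_leaf_of_isAcyclic {W : Type*} [Finite W] {H : SimpleGraph W} (hH : H.IsAcyclic)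
    {a b : W} (hab : H.Adj a b) : ∃ u w, H.Adj u w ∧ ∀ z, H.Adj u z → z = w := by
  classical
  have := Fintype.ofFinite W
  let c := H.connectedComponentMk a
  have ht := hH.isTree_connectedComponent c
  have ha : a ∈ c.supp := by simp [c]
  have hb : b ∈ c.supp := by
    rw [ConnectedComponent.mem_supp_iff]; exact ConnectedComponent.sound hab.symm.reachable
  have : Nontrivial c := ⟨⟨a, ha⟩, ⟨b, hb⟩, by simpa using hab.ne⟩
  obtain ⟨u, hu⟩ := ht.exists_vert_degree_one_of_nontrivial
  obtain ⟨w, hw, hw'⟩ := degree_eq_one_iff_existsUnique_adj.1 hu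
  refine ⟨u, w, hw, fun z hz => ?_⟩
  have hzc : z ∈ c.supp := by
    have := u.2
    rw [ConnectedComponent.mem_supp_iff]
    exact (ConnectedComponent.sound hz.symm.reachable).trans this
  exact congrArg Subtype.val (hw' ⟨z, hzc⟩ hz)

lemma exists_leaf_on (hG : G.IsAcyclic) {S : Finset V} (hS : ¬ G.IsIndepSet S) :
    ∃ u ∈ S, ∃ w ∈ S, G.Adj u w ∧ ∀ z ∈ S, G.Adj u z → z = w := by
  simp only [IsIndepSet, Set.Pairwise, not_forall, not_not] at hS
  obtain ⟨a, ha, b, hb, -, hab⟩ := hS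
  obtain ⟨u, w, huw, hu⟩ := exists_leaf_of_isAcyclic (hG.induce (S : Set V))
    (a := ⟨a, ha⟩) (b := ⟨b, hb⟩) hab
  exact ⟨u, u.2, w, w.2, huw, fun z hz h => congrArg Subtype.val (hu ⟨z, hz⟩ h)⟩

/-- In an acyclic graph, every vertex set `S` contains an independent set and a matching with `|S|`
elements in total; and the independent set is counted by the null decomposition. -/
lemma exists_isIndepSet_isMatching (hG : G.IsAcyclic) (S : Finset V) :
    ∃ I ⊆ S, G.IsIndepSet I ∧ (∃ M : G.Subgraph, M.IsMatching ∧ M.verts ⊆ S ∧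
      #I + M.edgeSet.ncard = #S) ∧ 2 * #I = 2 * #(suppOn G S) + #(farOn G S) := by
  classical
  induction S using Finset.strongInduction with
  | H S ih =>
  by_cases hS : G.IsIndepSet S
  · refine ⟨S, Subset.rfl, hS, ⟨⊥, ?_, by simp, by simp⟩, ?_⟩
    · intro v hv; simp at hv
    · have : farOn G S = ∅ := by
        ext v; simp [mem_farOn, suppOn_eq_of_isIndepSet hS]; tauto
      rw [suppOn_eq_of_isIndepSet hS, this]; simp
  · obtain ⟨u, huS, w, hw, huw, hu⟩ := exists_leaf_on hG hS
    have hsub : ({u, w} : Finset V) ⊆ S := by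
      intro z; simp only [mem_insert, mem_singleton]; rintro (rfl | rfl) <;> assumption
    have hcard : #(S \ {u, w}) + 2 = #S := by
      rw [← card_pair huw.ne, card_sdiff_add_card_eq_card hsub]
    obtain ⟨I, hIS, hI, ⟨M, hM, hMS, hMc⟩, hIc⟩ := ih (S \ {u, w})
      (sdiff_ssubset hsub ⟨u, by simp⟩)
    have huI : u ∉ I := fun h => by simpa using hIS h
    have hcross : ∀ b ∈ I, ¬ G.Adj u b := by
      intro b hb hub
      have := hIS hb
      simp only [mem_sdiff, mem_insert, mem_singleton, not_or] at this
      exact this.2.2 (hu b this.1 hub)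
    -- The leaf `u` joins the independent set and the edge `uw` joins the matching.
    refine ⟨insert u I, insert_subset huS (hIS.trans sdiff_subset), ?_,
      ⟨M ⊔ G.subgraphOfAdj huw, ?_, ?_, ?_⟩, ?_⟩
    · intro a ha b hb hab h
      simp only [coe_insert, Set.mem_insert_iff, mem_coe] at ha hb
      rcases ha with rfl | ha <;> rcases hb with rfl | hb
      · exact hab rfl
      · exact hcross b hb h
      · exact hcross a ha h.symm
      · exact hI ha hb hab h
    · refine hM.sup (Subgraph.IsMatching.subgraphOfAdj huw) ?_
      rw [hM.support_eq_verts, (Subgraph.IsMatching.subgraphOfAdj huw).support_eq_verts,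
        Set.disjoint_left]
      intro z hz hz'
      have := hMS hz
      simp at this hz'
      tauto
    · rw [Subgraph.verts_sup]
      refine Set.union_subset (hMS.trans (by simp)) ?_
      intro z hz
      exact hsub (by simpa using hz)
    · have huM : s(u, w) ∉ M.edgeSet := by
        intro h
        have := hMS (M.edge_vert h)
        simp at this
      rw [Subgraph.edgeSet_sup, edgeSet_subgraphOfAdj, Set.union_singleton,
        Set.ncard_insert_of_notMem huM (Set.toFinite _), card_insert_of_notMem huI]
      omega
    · rw [card_insert_of_notMem huI, card_suppOn_add_card_farOn hG huS hw huw hu]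
      omega

/-- Independent sets are at most as large as the complement of the edge set of a matching. -/
lemma card_add_ncard_edgeSet_le {J S : Finset V} (hJ : G.IsIndepSet J) (hJS : J ⊆ S)
    {M : G.Subgraph} (hM : M.IsMatching) (hMS : M.verts ⊆ S) :
    #J + M.edgeSet.ncard ≤ #S := by
  classical
  cases isEmpty_or_nonempty V
  · have : M.edgeSet = ∅ := by
      ext e; induction e with | h a b => exact isEmptyElim a
    simp [this, card_le_card hJS]
  -- Choosing an end outside `J` for each edge is injective, as distinct matching edges share no
  -- vertex.
  have hex : ∀ e ∈ M.edgeSet, ∃ v, v ∈ e ∧ v ∈ S \ J := by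
    intro e he
    induction e with
    | h a b =>
    have hab : M.Adj a b := he
    by_cases ha : a ∈ J
    · refine ⟨b, by simp, mem_sdiff.2 ⟨hMS (M.edge_vert hab.symm), fun hb => ?_⟩⟩
      exact hJ ha hb hab.adj_sub.ne hab.adj_sub
    · exact ⟨a, by simp, mem_sdiff.2 ⟨hMS (M.edge_vert hab), ha⟩⟩
  choose! f hf hf' using hex
  have : M.edgeSet.ncard ≤ (((S \ J : Finset V) : Set V)).ncard := by
    refine Set.ncard_le_ncard_of_injOn f (fun e he => by exact_mod_cast hf' e he) ?_ (Set.toFinite _)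
    intro e he e' he' h
    have h1 := hf e he
    have h2 := hf e' he'
    rw [← h] at h2
    generalize f e = c at h1 h2
    obtain ⟨a, rfl⟩ := Sym2.mem_iff_exists.1 h1
    obtain ⟨b, rfl⟩ := Sym2.mem_iff_exists.1 h2
    rw [hM.eq_of_adj_left (Subgraph.mem_edgeSet.1 he) (Subgraph.mem_edgeSet.1 he')]
  rw [Set.ncard_coe_finset, card_sdiff_of_subset hJS] at this
  have := card_le_card hJS
  omega

end Forest

/-! ### Independence numbers of induced subgraphs, components and forests -/

section IndepNum

variable {V : Type*} [Finite V] {G : SimpleGraph V}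

lemma card_le_indepNum_induce {S : Set V} {K : Finset V} (hK : G.IsIndepSet K) (hKS : ↑K ⊆ S) :
    #K ≤ (G.induce S).indepNum := by
  classical
  have := Fintype.ofFinite V
  have h : #(K.subtype (· ∈ S)) = #K := by
    rw [card_subtype, filter_true_of_mem fun x hx => hKS hx]
  rw [← h]
  refine IsIndepSet.card_le_indepNum ?_
  intro a ha b hb hab hadj
  exact hK (by simpa using ha) (by simpa using hb) (fun h => hab (Subtype.ext h)) hadj

lemma exists_card_eq_indepNum_induce (G : SimpleGraph V) (S : Set V) :
    ∃ K : Finset V, G.IsIndepSet K ∧ ↑K ⊆ S ∧ #K = (G.induce S).indepNum := by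
  classical
  have := Fintype.ofFinite V
  obtain ⟨s, hs, hc⟩ := (G.induce S).exists_isNIndepSet_indepNum
  refine ⟨s.map (Function.Embedding.subtype _), ?_, ?_, by simpa using hc⟩
  · intro a ha b hb hab hadj
    simp only [coe_map, Function.Embedding.subtype_apply, Set.mem_image, mem_coe] at ha hb
    obtain ⟨a, ha, rfl⟩ := ha
    obtain ⟨b, hb, rfl⟩ := hb
    exact hs ha hb (fun h => hab (congrArg _ h)) hadj
  · intro a ha
    simp only [coe_map, Function.Embedding.subtype_apply, Set.mem_image, mem_coe] at ha
    obtain ⟨a, ha, rfl⟩ := ha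
    exact a.2

/-- The independence number is additive over the connected components. -/
lemma indepNum_eq_finsum (G : SimpleGraph V) :
    G.indepNum = ∑ᶠ T : G.ConnectedComponent, T.toSimpleGraph.indepNum := by
  classical
  have := Fintype.ofFinite V
  have := Fintype.ofFinite G.ConnectedComponent
  rw [finsum_eq_sum_of_fintype]
  apply le_antisymm
  · obtain ⟨I, hI, hc⟩ := G.exists_isNIndepSet_indepNum
    rw [← hc, card_eq_sum_card_fiberwise (f := G.connectedComponentMk) (t := univ)
      (fun _ _ => by simp)]
    refine sum_le_sum fun T _ => ?_
    refine card_le_indepNum_induce (hI.mono (coe_subset.2 (filter_subset _ _))) ?_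
    intro v hv
    simpa using (mem_filter.1 hv).2
  · choose K hK hKS hc using fun T : G.ConnectedComponent =>
      exists_card_eq_indepNum_induce G T.supp
    have hmem : ∀ T, ∀ v ∈ K T, G.connectedComponentMk v = T := fun T v hv => hKS T hv
    have h1 : ∑ T : G.ConnectedComponent, T.toSimpleGraph.indepNum = #(univ.biUnion K) := by
      rw [card_biUnion]
      · exact sum_congr rfl fun T _ => (hc T).symm
      · intro T _ T' _ hne
        rw [Function.onFun, Finset.disjoint_left]
        intro v hv hv'
        exact hne ((hmem T v hv).symm.trans (hmem T' v hv'))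
    rw [h1]
    refine IsIndepSet.card_le_indepNum ?_
    intro a ha b hb hab hadj
    simp only [coe_biUnion, coe_univ, Set.mem_univ, Set.iUnion_true, Set.mem_iUnion, mem_coe] at ha hb
    obtain ⟨T, ha⟩ := ha
    obtain ⟨T', hb⟩ := hb
    have : T = T' := by
      rw [← hmem T a ha, ← hmem T' b hb]
      exact ConnectedComponent.sound hadj.reachable
    subst this
    exact hK T ha hb hab hadj

/-- The independence number of a forest, through its null decomposition. -/
lemma indepNum_of_isAcyclic (hG : G.IsAcyclic) :
    (G.indepNum : ℚ) = (supp G).ncard + ((nForest G).verts.ncard : ℚ) / 2 := by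
  classical
  have := Fintype.ofFinite V
  obtain ⟨I, -, hI, ⟨M, hM, hMS, hc⟩, h2⟩ := exists_isIndepSet_isMatching hG univ
  have hs : ((suppOn G univ : Finset V) : Set V) = supp G := by
    ext v
    have hnull : ∀ x, IsNullOn G univ x ↔ x ∈ nullSpace G := by
      intro x
      simp only [IsNullOn, nullSpace, LinearMap.mem_ker, Matrix.mulVecLin_apply, funext_iff]
      simp
      rw [Subsingleton.elim (Fintype.ofFinite V)]
    simp [mem_suppOn, supp, hnull]
  have hf : ((farOn G univ : Finset V) : Set V) = (nForest G).verts := by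
    ext v
    have : ∀ z, z ∈ suppOn G univ ↔ z ∈ supp G := by intro z; rw [← hs]; simp
    simp [mem_farOn, nForest, sForest, closedNeighborhood, this]
  have hmax : G.indepNum = #I := by
    refine le_antisymm ?_ hI.card_le_indepNum
    obtain ⟨J, hJ, hJc⟩ := G.exists_isNIndepSet_indepNum
    have := card_add_ncard_edgeSet_le hJ (subset_univ J) hM hMS
    omega
  rw [hmax, ← hs, ← hf, Set.ncard_coe_finset, Set.ncard_coe_finset]
  have : (2 * #I : ℚ) = 2 * #(suppOn G univ) + #(farOn G univ) := by exact_mod_cast h2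
  linarith

/-- A mismatched vertex of a forest lies in some maximum independent set. -/
lemma exists_isIndepSet_of_isMismatched (hG : G.IsAcyclic) {v : V} (hv : IsMismatched G v) :
    ∃ J : Finset V, G.IsIndepSet J ∧ ∀ K : Finset V, G.IsIndepSet K → v ∉ K → #K + 1 ≤ #J := by
  classical
  have := Fintype.ofFinite V
  obtain ⟨I, -, hI, ⟨M, hM, -, hc⟩, -⟩ := exists_isIndepSet_isMatching hG univ
  obtain ⟨N, ⟨hN, hmax⟩, hvN⟩ := hv
  refine ⟨I, hI, fun K hK hvK => ?_⟩
  have h1 := hmax M hM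
  -- Both `K` and `N` avoid `v`, so the bound holds with one vertex fewer; this is the gain of 1.
  have h2 := card_add_ncard_edgeSet_le (S := univ.erase v) hK (fun z hz => by
    simp; rintro rfl; exact hvK hz) hN (fun z hz => by simp; rintro rfl; exact hvN hz)
  have h3 := card_erase_add_one (mem_univ v)
  omega

end IndepNum

/-! ### Pendant trees as components after deleting the cycle edges -/

section Unicyclic

variable {V : Type*} {G : SimpleGraph V} {C : G.Subgraph}

lemma IsUnicyclic.eq_of_isCycle (hG : IsUnicyclic G) (hC : IsCycleSubgraph C) {v : V}
    {p : G.Walk v v} (hp : p.IsCycle) : p.toSubgraph = C :=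
  hG.2.unique ⟨v, p, hp, rfl⟩ hC

lemma IsUnicyclic.isAcyclic_deleteEdges (hG : IsUnicyclic G) (hC : IsCycleSubgraph C) {e : Sym2 V}
    (he : e ∈ C.edgeSet) : (G.deleteEdges {e}).IsAcyclic := by
  intro v c hc
  have hle : G.deleteEdges {e} ≤ G := G.deleteEdges_le _
  have h := hG.eq_of_isCycle hC (hc.mapLe hle)
  rw [← h, Walk.mem_edges_toSubgraph, Walk.edges_mapLe_eq_edges] at he
  have := c.edges_subset_edgeSet he
  simp [edgeSet_deleteEdges] at this

/-- Without the edges of the cycle, its vertices are pairwise disconnected. -/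
lemma IsUnicyclic.eq_of_reachable (hG : IsUnicyclic G) (hC : IsCycleSubgraph C) {v v' : V}
    (hv : v ∈ C.verts) (hv' : v' ∈ C.verts) (h : (G.deleteEdges C.edgeSet).Reachable v' v) :
    v = v' := by
  classical
  by_contra hne
  obtain ⟨u, p, hp, rfl⟩ := hC
  have hC : IsCycleSubgraph p.toSubgraph := ⟨u, p, hp, rfl⟩
  rw [Walk.mem_verts_toSubgraph] at hv hv'
  -- Started at `v` and stripped of its first edge `vs`, the cycle is a path from `s` to `v` through
  -- `v'`.
  have hq := hp.rotate hv
  have hs : v' ∈ (p.rotate v hv).support := by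
    rw [← Walk.mem_verts_toSubgraph, Walk.toSubgraph_rotate, Walk.mem_verts_toSubgraph]; exact hv'
  have hsub : (p.rotate v hv).toSubgraph = p.toSubgraph := Walk.toSubgraph_rotate ..
  generalize p.rotate v hv = q at hq hs hsub
  cases q with
  | nil => exact hq.ne_nil rfl
  | @cons _ s _ hadj q =>
  rw [Walk.cons_isCycle_iff] at hq
  rw [Walk.support_cons, List.mem_cons] at hs
  replace hs : v' ∈ q.support := hs.resolve_left (fun h => hne h.symm)
  have he : s(v, s) ∈ p.toSubgraph.edgeSet := by
    rw [← hsub, Walk.mem_edges_toSubgraph]; simp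
  have hac := hG.isAcyclic_deleteEdges hC he
  have hr : ∀ e ∈ (q.dropUntil v' hs).edges, e ∉ ({s(v, s)} : Set (Sym2 V)) := by
    rintro e he' rfl
    exact hq.2 (q.edges_dropUntil_subset_edges hs he')
  obtain ⟨r, hrp⟩ := h.exists_isPath
  have hle : G.deleteEdges p.toSubgraph.edgeSet ≤ G.deleteEdges {s(v, s)} :=
    deleteEdges_anti (by simpa using he)
  -- Paths in the forest `G - vs` are unique, yet one path from `v'` to `v` follows `C` and the
  -- other avoids its edges. Their common first edge is the contradiction.
  have heq := (hac.subsingleton_path v' v).elim ⟨_, hrp.mapLe hle⟩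
    ⟨(q.dropUntil v' hs).toDeleteEdges _ hr, (hq.1.dropUntil hs).toDeleteEdges _ _ hr⟩
  have hedges := congrArg (fun w => w.1.edges) heq
  simp only [Walk.edges_mapLe_eq_edges] at hedges
  cases r with
  | nil => exact hne rfl
  | @cons _ b _ hb r =>
  have h1 : s(v', b) ∈ (q.dropUntil v' hs).edges := by
    have : s(v', b) ∈ ((q.dropUntil v' hs).toDeleteEdges _ hr).edges := by rw [← hedges]; simp
    simpa [Walk.toDeleteEdges, Walk.edges_transfer] using this
  have h2 : s(v', b) ∈ p.toSubgraph.edgeSet := by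
    rw [← hsub, Walk.mem_edges_toSubgraph, Walk.edges_cons]
    exact List.mem_cons_of_mem _ (q.edges_dropUntil_subset_edges hs h1)
  exact ((deleteEdges_adj ..).1 hb).2 h2

/-- An edge of `C` has two distinct ends in `C`, so a walk meeting `C` only in `v` uses none; the
converse is `IsUnicyclic.eq_of_reachable`. -/
lemma IsUnicyclic.mem_pendantVerts (hG : IsUnicyclic G) (hC : IsCycleSubgraph C) {v w : V}
    (hv : v ∈ C.verts) : w ∈ pendantVerts G C v ↔ (G.deleteEdges C.edgeSet).Reachable v w := by
  classical
  constructor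
  · rintro ⟨p, hp⟩
    refine ⟨p.toDeleteEdges _ fun e he he' => ?_⟩
    induction e with
    | h a b =>
    have hab : C.Adj a b := he'
    exact hab.ne ((hp a (p.fst_mem_support_of_mem_edges he) (C.edge_vert hab)).trans
      (hp b (p.snd_mem_support_of_mem_edges he) (C.edge_vert hab.symm)).symm)
  · rintro ⟨p⟩
    refine ⟨p.mapLe (G.deleteEdges_le _), fun x hx hxC => ?_⟩
    rw [Walk.support_mapLe_eq_support] at hx
    exact hG.eq_of_reachable hC hxC hv (p.takeUntil x hx).reachable

lemma exists_reachable_deleteEdges (hG : G.Preconnected) {u : V} (hu : u ∈ C.verts) (w : V) :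
    ∃ v ∈ C.verts, (G.deleteEdges C.edgeSet).Reachable v w := by
  obtain ⟨p⟩ := hG w u
  induction p with
  | nil => exact ⟨_, hu, Reachable.refl _⟩
  | @cons a b _ h p ih =>
    by_cases ha : a ∈ C.verts
    · exact ⟨a, ha, Reachable.refl _⟩
    · obtain ⟨v, hv, hr⟩ := ih hu
      refine ⟨v, hv, hr.trans (Adj.reachable ?_)⟩
      rw [deleteEdges_adj]
      exact ⟨h.symm, fun h' => ha (C.edge_vert (Subgraph.Adj.symm (G' := C) h'))⟩

end Unicyclic

/-! ### Independent sets of a cycle -/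

section Cycle

variable {V : Type*} {G : SimpleGraph V} {v : V} {p : G.Walk v v}

open Classical in
lemma isCycle_mem_verts_iff (hp : p.IsCycle) (w : V) :
    w ∈ p.toSubgraph.verts ↔ w ∈ (range p.length).image p.getVert := by
  have hl := hp.three_le_length
  rw [Walk.mem_verts_toSubgraph, Walk.mem_support_iff_exists_getVert, mem_image]
  constructor
  · rintro ⟨n, rfl, hn⟩
    -- The index `p.length` repeats the vertex of index 0.
    rcases hn.eq_or_lt with rfl | hn
    · exact ⟨0, by simp; omega, by simp⟩
    · exact ⟨n, by simpa, rfl⟩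
  · rintro ⟨n, hn, rfl⟩
    exact ⟨n, rfl, (mem_range.1 hn).le⟩

lemma isCycle_getVert_injOn_range (hp : p.IsCycle) :
    Set.InjOn p.getVert (range p.length : Finset ℕ) :=
  hp.getVert_injOn'.mono fun i hi => by
    have := mem_range.1 (mem_coe.1 hi)
    simp only [Set.mem_ofPred_eq]
    omega

lemma isCycle_ncard_verts (hp : p.IsCycle) : p.toSubgraph.verts.ncard = p.length := by
  classical
  have : p.toSubgraph.verts = ((range p.length).image p.getVert : Finset V) := by
    ext w; rw [isCycle_mem_verts_iff hp, mem_coe]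
  rw [this, Set.ncard_coe_finset, card_image_of_injOn (isCycle_getVert_injOn_range hp), card_range]

/-- Take the odd indices below `p.length`. No two are consecutive, and omitting index 0 avoids a
clash at the wrap-around when the length is odd. -/
lemma exists_isCycle_indep (hp : p.IsCycle) : ∃ I : Finset V, ↑I ⊆ p.toSubgraph.verts ∧
    (∀ a ∈ I, ∀ b ∈ I, ¬ p.toSubgraph.Adj a b) ∧ #I = p.length / 2 := by
  classical
  have hinj := isCycle_getVert_injOn_range hp
  refine ⟨(range (p.length / 2)).image fun j => p.getVert (2 * j + 1), ?_, ?_, ?_⟩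
  · intro w hw
    obtain ⟨j, hj, rfl⟩ := mem_image.1 (mem_coe.1 hw)
    rw [mem_range] at hj
    rw [isCycle_mem_verts_iff hp]
    exact mem_image_of_mem _ (by rw [mem_range]; omega)
  · have key : ∀ i j, i < p.length → j < p.length / 2 → p.getVert i = p.getVert (2 * j + 1) →
        i = 2 * j + 1 := by
      intro i j hi hj h
      exact hinj (by simpa using hi) (by simp; omega) h
    have key' : ∀ i j, i < p.length → j < p.length / 2 →
        p.getVert (i + 1) = p.getVert (2 * j + 1) → i = 2 * j := by
      intro i j hi hj h
      rcases Nat.lt_or_ge (i + 1) p.length with h1 | h1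
      · have := key (i + 1) j h1 hj h; omega
      · have h2 : i + 1 = p.length := by omega
        rw [h2, Walk.getVert_length] at h
        have := key 0 j (by omega) hj (by simpa using h)
        omega
    intro a ha b hb hab
    obtain ⟨j, hj, rfl⟩ := mem_image.1 ha
    obtain ⟨k, hk, rfl⟩ := mem_image.1 hb
    rw [mem_range] at hj hk
    obtain ⟨i, he, hi⟩ := (Walk.toSubgraph_adj_iff p).1 hab
    rw [Sym2.eq_iff] at he
    rcases he with ⟨h1, h2⟩ | ⟨h1, h2⟩
    · have := key i j hi hj h1
      have := key' i k hi hk h2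
      omega
    · have := key i k hi hk h1
      have := key' i j hi hj h2
      omega
  · rw [card_image_of_injOn, card_range]
    intro j hj k hk h
    have hj := mem_range.1 (mem_coe.1 hj)
    have hk := mem_range.1 (mem_coe.1 hk)
    have := hinj (x₁ := 2 * j + 1) (x₂ := 2 * k + 1) (by simp; omega) (by simp; omega) h
    omega

/-- The indices of `K` and their shift by one step along the cycle are disjoint by independence, so
twice `#K` fits into `p.length`. -/
lemma card_le_of_subset_isCycle (hp : p.IsCycle) {K : Finset V} (hK : G.IsIndepSet K)
    (hKC : ↑K ⊆ p.toSubgraph.verts) : #K ≤ p.length / 2 := by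
  classical
  have h1 : #K = #{i ∈ range p.length | p.getVert i ∈ K} := by
    have : K = {i ∈ range p.length | p.getVert i ∈ K}.image p.getVert := by
      ext w
      simp only [mem_image, mem_filter]
      constructor
      · intro hw
        obtain ⟨i, hi, rfl⟩ := mem_image.1 ((isCycle_mem_verts_iff hp w).1 (hKC hw))
        exact ⟨i, ⟨hi, hw⟩, rfl⟩
      · rintro ⟨i, ⟨-, hi⟩, rfl⟩; exact hi
    conv_lhs => rw [this]
    exact card_image_of_injOn ((isCycle_getVert_injOn_range hp).mono (by
      intro i hi; exact (mem_filter.1 hi).1))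
  have h2 : #K ≤ #{i ∈ range p.length | p.getVert (i + 1) ∈ K} := by
    have : K ⊆ {i ∈ range p.length | p.getVert (i + 1) ∈ K}.image fun i => p.getVert (i + 1) := by
      intro w hw
      obtain ⟨i, hi, rfl⟩ := mem_image.1 ((isCycle_mem_verts_iff hp w).1 (hKC hw))
      rw [mem_range] at hi
      rw [mem_image]
      rcases i.eq_zero_or_pos with rfl | h0
      · have : p.getVert (p.length - 1 + 1) = p.getVert 0 := by
          rw [Nat.sub_add_cancel (by omega)]; simp
        exact ⟨p.length - 1, by simp only [mem_filter, mem_range, this]; exact ⟨by omega, hw⟩, this⟩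
      · have : i - 1 + 1 = i := by omega
        exact ⟨i - 1, by simp only [mem_filter, mem_range, this]; exact ⟨by omega, hw⟩, by rw [this]⟩
    exact (card_le_card this).trans card_image_le
  have hd : Disjoint {i ∈ range p.length | p.getVert i ∈ K}
      {i ∈ range p.length | p.getVert (i + 1) ∈ K} := by
    rw [Finset.disjoint_left]
    intro i hi hi'
    simp only [mem_filter, mem_range] at hi hi'
    have hadj := p.adj_getVert_succ hi.1
    exact hK hi.2 hi'.2 hadj.ne hadj
  have h3 := card_le_card (union_subset (filter_subset (p.getVert · ∈ K) (range p.length))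
    (filter_subset (fun i => p.getVert (i + 1) ∈ K) (range p.length)))
  rw [card_union_of_disjoint hd, card_range] at h3
  omega

end Cycle

/-! ### Splitting the independence number of a Type II graph along its cycle -/

section TypeII

variable {V : Type*} {G : SimpleGraph V} {C : G.Subgraph}

lemma IsUnicyclic.isAcyclic_of_subset (hG : IsUnicyclic G) (hC : IsCycleSubgraph C) {S : Set V}
    (hS : ¬ C.verts ⊆ S) : (G.induce S).IsAcyclic := by
  intro v c hc
  have h := hG.eq_of_isCycle hC (hc.map (f := (Embedding.induce S).toHom) Subtype.val_injective)
  refine hS fun w hw => ?_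
  rw [← h, Walk.mem_verts_toSubgraph, Walk.support_map, List.mem_map] at hw
  obtain ⟨y, -, rfl⟩ := hw
  exact y.2

lemma IsCycleSubgraph.exists_ne (hC : IsCycleSubgraph C) (v : V) : ∃ w ∈ C.verts, w ≠ v := by
  obtain ⟨u, p, hp, rfl⟩ := hC
  by_cases h : u = v
  · exact ⟨p.snd, p.mem_verts_toSubgraph.2 (p.getVert_mem_support 1),
      h ▸ (p.adj_snd hp.not_nil).ne'⟩
  · exact ⟨u, by simp, h⟩

lemma IsTypeII.isMismatched (hG : IsTypeII G) (hC : IsCycleSubgraph C) {v : V}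
    (hv : v ∈ C.verts) :
    IsMismatched (pendantTree G C v) ⟨v, mem_pendantVerts_self G C v⟩ := by
  by_contra h
  exact hG.2 ⟨hG.1, C, hC, v, hv, h⟩

variable [Finite V]

/-- A pendant tree of a graph of Type II has an independent set which is larger than those that
avoid the vertex of the cycle. -/
lemma IsTypeII.exists_isIndepSet_pendant (hG : IsTypeII G) (hC : IsCycleSubgraph C) {v : V}
    (hv : v ∈ C.verts) : ∃ J : Finset V, G.IsIndepSet J ∧ ↑J ⊆ pendantVerts G C v ∧
      ∀ K : Finset V, G.IsIndepSet K → ↑K ⊆ pendantVerts G C v → v ∉ K → #K + 1 ≤ #J := by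
  classical
  have hac : (pendantTree G C v).IsAcyclic := by
    obtain ⟨w, hw, hne⟩ := hC.exists_ne v
    exact hG.1.isAcyclic_of_subset hC fun h => hne ((pendantVerts_isGreatest G C v).1.2.2 w (h hw) hw)
  obtain ⟨J, hJ, hJK⟩ := exists_isIndepSet_of_isMismatched hac (hG.isMismatched hC hv)
  refine ⟨J.map (Function.Embedding.subtype _), ?_, ?_, ?_⟩
  · intro a ha b hb hab hadj
    simp only [coe_map, Function.Embedding.subtype_apply, Set.mem_image, mem_coe] at ha hb
    obtain ⟨a, ha, rfl⟩ := ha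
    obtain ⟨b, hb, rfl⟩ := hb
    exact hJ ha hb (fun h => hab (congrArg _ h)) hadj
  · intro a ha
    simp only [coe_map, Function.Embedding.subtype_apply, Set.mem_image, mem_coe] at ha
    obtain ⟨a, ha, rfl⟩ := ha
    exact a.2
  · intro K hK hKS hvK
    have h : #(K.subtype (· ∈ pendantVerts G C v)) = #K := by
      rw [card_subtype, filter_true_of_mem fun x hx => hKS hx]
    rw [card_map, ← h]
    refine hJK _ ?_ (by simpa using hvK)
    intro a ha b hb hab hadj
    exact hK (by simpa using ha) (by simpa using hb) (fun h => hab (Subtype.ext h)) hadj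

/-- In a graph of Type II an independent set of the cycle extends to an independent set which has
as many further vertices as any independent set disjoint from the cycle. -/
lemma IsTypeII.exists_isIndepSet_extend (hG : IsTypeII G) (hC : IsCycleSubgraph C)
    {I K : Finset V} (hIC : ↑I ⊆ C.verts) (hI : ∀ a ∈ I, ∀ b ∈ I, ¬ C.Adj a b)
    (hK : G.IsIndepSet K) (hKC : ↑K ⊆ C.vertsᶜ) :
    ∃ J : Finset V, G.IsIndepSet J ∧ #J = #I + #K := by
  classical
  have := Fintype.ofFinite V
  have hJ : ∀ v, ∃ J : Finset V, v ∈ C.verts → G.IsIndepSet J ∧ ↑J ⊆ pendantVerts G C v ∧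
      ∀ K : Finset V, G.IsIndepSet K → ↑K ⊆ pendantVerts G C v → v ∉ K → #K + 1 ≤ #J := by
    intro v
    by_cases hv : v ∈ C.verts
    · obtain ⟨J, h⟩ := hG.exists_isIndepSet_pendant hC hv
      exact ⟨J, fun _ => h⟩
    · exact ⟨∅, fun h => absurd h hv⟩
  choose J hJ using hJ
  have hr : ∀ v ∈ C.verts, ∀ w ∈ J v, (G.deleteEdges C.edgeSet).Reachable v w := fun v hv w hw =>
    (hG.1.mem_pendantVerts hC hv).1 ((hJ v hv).2.1 hw)
  have huniq : ∀ v ∈ C.verts, ∀ v' ∈ C.verts, ∀ w,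
      (G.deleteEdges C.edgeSet).Reachable v w → (G.deleteEdges C.edgeSet).Reachable v' w → v = v' :=
    fun v hv v' hv' w h h' => hG.1.eq_of_reachable hC hv hv' (h'.trans h.symm)
  let c : Finset V := {v | v ∈ C.verts}
  have hc : ∀ v, v ∈ c ↔ v ∈ C.verts := by simp [c]
  have hdisj : ∀ L : V → Finset V, (∀ v ∈ C.verts, L v ⊆ J v) → #(c.biUnion L) = ∑ v ∈ c, #(L v) := by
    intro L hL
    refine card_biUnion fun v hv v' hv' hne => ?_
    rw [Function.onFun, Finset.disjoint_left]
    intro w hw hw'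
    have hv := (hc v).1 hv
    have hv' := (hc v').1 hv'
    exact hne (huniq v hv v' hv' w (hr v hv w (hL v hv hw)) (hr v' hv' w (hL v' hv' hw')))
  let B := c.biUnion J
  -- In each pendant tree the part of `K` avoids `v`, so `J v` beats it by one; summing over the
  -- cycle gains `#c`.
  have hBcard : #K + #c ≤ #B := by
    obtain ⟨u, hu⟩ : ∃ u, u ∈ C.verts := by
      obtain ⟨u, p, -, rfl⟩ := hC; exact ⟨u, by simp⟩
    have hcov : K ⊆ c.biUnion fun v => {w ∈ K | w ∈ pendantVerts G C v} := by
      intro w hw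
      obtain ⟨v, hv, hvw⟩ := exists_reachable_deleteEdges hG.1.1.preconnected hu w
      rw [mem_biUnion]
      exact ⟨v, (hc v).2 hv, mem_filter.2 ⟨hw, (hG.1.mem_pendantVerts hC hv).2 hvw⟩⟩
    have h1 := (card_le_card hcov).trans card_biUnion_le
    have h2 : ∑ v ∈ c, (#{w ∈ K | w ∈ pendantVerts G C v} + 1) ≤ ∑ v ∈ c, #(J v) := by
      refine sum_le_sum fun v hv => ?_
      have hv := (hc v).1 hv
      refine (hJ v hv).2.2 _ (hK.mono (coe_subset.2 (filter_subset _ _))) ?_ ?_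
      · intro w hw; exact (mem_filter.1 hw).2
      · intro h; exact hKC (mem_filter.1 h).1 hv
    rw [sum_add_distrib, sum_const, smul_eq_mul, mul_one] at h2
    have h3 := hdisj J fun _ _ => Subset.rfl
    change #B = _ at h3
    omega
  have hIc : I ⊆ c := fun v hv => (hc v).2 (hIC hv)
  have hle : #I + #K ≤ #(B \ (c \ I)) := by
    have h1 := le_card_sdiff (c \ I) B
    have h2 := card_sdiff_add_card_eq_card hIc
    omega
  obtain ⟨J', hJ', hcard⟩ := exists_subset_card_eq hle
  refine ⟨J', ?_, hcard⟩
  intro a ha b hb _ hadj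
  have ha := mem_sdiff.1 (hJ' ha)
  have hb := mem_sdiff.1 (hJ' hb)
  simp only [mem_sdiff, not_and, not_not, hc] at ha hb
  -- An edge of `C` would have both ends in `I`; any other edge stays within one pendant tree, where
  -- `J v` is independent.
  by_cases hCab : C.Adj a b
  · exact hI a (ha.2 (C.edge_vert hCab)) b (hb.2 (C.edge_vert hCab.symm)) hCab
  · obtain ⟨v, hv, hav⟩ := mem_biUnion.1 ha.1
    obtain ⟨v', hv', hbv'⟩ := mem_biUnion.1 hb.1
    have hv := (hc v).1 hv
    have hv' := (hc v').1 hv'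
    have hab : (G.deleteEdges C.edgeSet).Adj a b := (deleteEdges_adj ..).2 ⟨hadj, hCab⟩
    have := huniq v hv v' hv' b ((hr v hv a hav).trans hab.reachable) (hr v' hv' b hbv')
    subst this
    exact (hJ v hv).1 hav hbv' hadj.ne hadj

lemma IsTypeII.indepNum_eq (hG : IsTypeII G) (hC : IsCycleSubgraph C) :
    G.indepNum = C.verts.ncard / 2 + (minus G C).indepNum := by
  classical
  have := Fintype.ofFinite V
  obtain ⟨u, p, hp, rfl⟩ := id hC
  rw [isCycle_ncard_verts hp]
  apply le_antisymm
  · obtain ⟨J, hJ, hc⟩ := G.exists_isNIndepSet_indepNum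
    rw [← hc, ← card_filter_add_card_filter_not (s := J) (· ∈ p.toSubgraph.verts)]
    refine add_le_add (card_le_of_subset_isCycle hp (hJ.mono (coe_subset.2 (filter_subset _ _))) ?_)
      (card_le_indepNum_induce (hJ.mono (coe_subset.2 (filter_subset _ _))) ?_)
    · intro w hw; exact (mem_filter.1 hw).2
    · intro w hw; exact (mem_filter.1 hw).2
  · obtain ⟨I, hIC, hI, hIc⟩ := exists_isCycle_indep hp
    obtain ⟨K, hK, hKC, hKc⟩ := exists_card_eq_indepNum_induce G p.toSubgraph.vertsᶜ
    obtain ⟨J, hJ, hJc⟩ := hG.exists_isIndepSet_extend hC hIC hI hK hKC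
    rw [minus, ← hIc, ← hKc, ← hJc]
    exact hJ.card_le_indepNum

end TypeII

end UnicyclicNull

/-- The sum ranges over the (finitely many) connected components `T` of `G - C`. -/
theorem mainTheorem3 {V : Type*} [Finite V] (G : SimpleGraph V) (C : G.Subgraph)
    (hC : UnicyclicNull.IsCycleSubgraph C) (hG : UnicyclicNull.IsTypeII G) :
    (G.indepNum : ℚ) = (⌊(C.verts.ncard : ℚ) / 2⌋ : ℚ) +
      ∑ᶠ T : (UnicyclicNull.minus G C).ConnectedComponent,
        (((UnicyclicNull.supp T.toSimpleGraph).ncard : ℚ) +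
          ((UnicyclicNull.nForest T.toSimpleGraph).verts.ncard : ℚ) / 2) := by
  have := Fintype.ofFinite (UnicyclicNull.minus G C).ConnectedComponent
  have hac : (UnicyclicNull.minus G C).IsAcyclic := by
    refine hG.1.isAcyclic_of_subset hC fun h => ?_
    obtain ⟨u, p, -, rfl⟩ := hC
    exact h (p.start_mem_verts_toSubgraph) p.start_mem_verts_toSubgraph
  have hfloor : ⌊(C.verts.ncard : ℚ) / 2⌋ = ((C.verts.ncard / 2 : ℕ) : ℤ) := by
    have := Rat.floor_natCast_div_natCast C.verts.ncard 2
    exact_mod_cast this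
  rw [hG.indepNum_eq hC, UnicyclicNull.indepNum_eq_finsum (UnicyclicNull.minus G C), hfloor,
    finsum_eq_sum_of_fintype, finsum_eq_sum_of_fintype]
  push_cast
  congr 1
  exact Finset.sum_congr rfl fun T _ => UnicyclicNull.indepNum_of_isAcyclic (hac.induce T.supp)
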